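/- Let $f\colon\mathbb R^n\times\mathbb R^p\to[-\infty,\infty]$ be a proper nearly convex function and let $F\colon\mathbb R^n\rightrightarrows\mathbb R^p$ be a nearly convex set-valued mapping. Here a set $\Omega$ is nearly convex if $C\subset\Omega\subset\overline C$ for some convex set $C$; $f$ is nearly convex if its epigraph $\{(z,\lambda)\mid f(z)\le\lambda\}$ is a nearly convex set; $f$ is proper if $\operatorname{dom} f=\{z\mid f(z)<\infty\}\ne\emptyset$ and $f>-\infty$ everywhere; and $F$ is nearly convex if its graph $\operatorname{gph}F=\{(x,y)\mid y\in F(x)\}$ is a nearly convex set. Suppose that $$\operatorname{ri}(\operatorname{dom} f)\cap\operatorname{ri}(\operatorname{gph}F)\neq\emptyset,$$ where $\operatorname{ri}$ denotes the relative interior (the interior relative to the affine hull). Let $$\mu(x)=\inf\{f(x,y)\mid y\in F(x)\}\quad(\inf\emptyset=\infty),\qquad S(x)=\{y\in F(x)\mid f(x,y)=\mu(x)\},\qquad x\in\mathbb R^n.$$ Then, for every $\bar x\in\mathbb R^n$ with $\mu(\bar x)\in\mathbb R$ and every $\bar y\in S(\bar x)$, $$\partial\mu(\bar x)=\bigcup_{(u,v)\in\partial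 f(\bar x,\bar y)}\big[u+D^*F(\bar x,\bar y)(v)\big].$$ Here the subdifferential of an extended-real-valued function $\varphi$ at a point $a$ with $\varphi(a)\in\mathbb R$ is $$\partial\varphi(a)=\{w\mid\langle w,z-a\rangle\le\varphi(z)-\varphi(a)\text{ for all }z\},$$ and the coderivative of $F$ at $(\bar x,\bar y)\in\operatorname{gph}F$ is $$D^*F(\bar x,\bar y)(v)=\{u\in\mathbb R^n\mid\langle u,x-\bar x\rangle-\langle v,y-\bar y\rangle\le0\text{ for all }(x,y)\in\operatorname{gph}F\},\qquad v\in\mathbb R^p.$$ -/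

import Mathlib

namespace NearConv

/-- The Euclidean space `ℝⁿ`. -/
abbrev Euc (n : ℕ) : Type := EuclideanSpace ℝ (Fin n)

/-- The product `ℝⁿ × ℝᵖ` with the Euclidean inner product
`⟪(u, v), (x, y)⟫ = ⟪u, x⟫ + ⟪v, y⟫`. -/
abbrev EucProd (n p : ℕ) : Type := WithLp 2 (Euc n × Euc p)

/-- The pair `(x, y)` as a point of `ℝⁿ × ℝᵖ`. -/
abbrev pair {n p : ℕ} (x : Euc n) (y : Euc p) : EucProd n p := WithLp.toLp 2 (x, y)

/-- A set `Ω` is nearly convex if `C ⊆ Ω ⊆ closure C` for some convex set `C`. -/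
def NearlyConvexSet {E : Type*} [AddCommGroup E] [Module ℝ E] [TopologicalSpace E]
    (Ω : Set E) : Prop :=
  ∃ C : Set E, Convex ℝ C ∧ C ⊆ Ω ∧ Ω ⊆ closure C

/-- The effective domain of an extended-real-valued function. -/
def effDom {E : Type*} (f : E → EReal) : Set E := {x | f x < ⊤}

/-- The epigraph of an extended-real-valued function. -/
def epigraph {E : Type*} (f : E → EReal) : Set (E × ℝ) := {q | f q.1 ≤ (q.2 : EReal)}

/-- A function is nearly convex if its epigraph is a nearly convex set. -/
def NearlyConvexFun {E : Type*} [AddCommGroup E] [Module ℝ E] [TopologicalSpace E]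
    (f : E → EReal) : Prop :=
  NearlyConvexSet (epigraph f)

/-- A function is proper if its effective domain is nonempty and it never takes the value `-∞`. -/
def ProperFun {E : Type*} (f : E → EReal) : Prop :=
  (effDom f).Nonempty ∧ ∀ x, ⊥ < f x

/-- The graph of a set-valued mapping `F : ℝⁿ ⇉ ℝᵖ`. -/
def graph {n p : ℕ} (F : Euc n → Set (Euc p)) : Set (EucProd n p) :=
  {z | z.snd ∈ F z.fst}

/-- A set-valued mapping is nearly convex if its graph is a nearly convex set. -/
def NearlyConvexMap {n p : ℕ} (F : Euc n → Set (Euc p)) : Prop :=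
  NearlyConvexSet (graph F)

/-- The normal cone to `Ω` at a point `a` (used for `a ∈ Ω`). -/
def normalCone {E : Type*} [NormedAddCommGroup E] [InnerProductSpace ℝ E]
    (a : E) (Ω : Set E) : Set E :=
  {v | ∀ x ∈ Ω, inner ℝ v (x - a) ≤ 0}

/-- The coderivative `D*F(x, y)(v) = {u | (u, -v) ∈ N((x, y); gph F)}`
(used for `y ∈ F x`). -/
def coderivative {n p : ℕ} (F : Euc n → Set (Euc p)) (x : Euc n) (y : Euc p)
    (v : Euc p) : Set (Euc n) :=
  {u | pair u (-v) ∈ normalCone (pair x y) (graph F)}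

/-- The subdifferential of `φ` at a point `a` (used for `φ a` finite, so that the difference
in `EReal` is the usual one). -/
def subdifferential {E : Type*} [NormedAddCommGroup E] [InnerProductSpace ℝ E]
    (φ : E → EReal) (a : E) : Set E :=
  {v | ∀ x, ((inner ℝ v (x - a) : ℝ) : EReal) ≤ φ x - φ a}

/-- The optimal value function `μ(x) = inf {f(x, y) | y ∈ F(x)}`, with `inf ∅ = ∞`. -/
noncomputable def optimalValue {n p : ℕ} (f : EucProd n p → EReal) (F : Euc n → Set (Euc p))
    (x : Euc n) : EReal :=
  ⨅ y ∈ F x, f (pair x y)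

/-- The solution map `S(x) = {y ∈ F(x) | f(x, y) = μ(x)}`. -/
def solutionMap {n p : ℕ} (f : EucProd n p → EReal) (F : Euc n → Set (Euc p))
    (x : Euc n) : Set (Euc p) :=
  {y | y ∈ F x ∧ f (pair x y) = optimalValue f F x}

end NearConv

/-! A subgradient `w` of the optimal value at `xbar` says that an affine function with slope `(w,
0)` minorizes `f` on the graph of `F` and touches it at `(xbar, ybar)`. Splitting `(w, 0)` into a
subgradient of `f` plus a normal to the graph is then the nontrivial inclusion
(`exists_subgradient_sub_mem_normalCone`); the other adds two inequalities. The splitting comes from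
`exists_proper_separation` in `E × ℝ`; the relative interior condition rules out a vertical
hyperplane. -/

namespace NearConv

section Separation

variable {E : Type*} [NormedAddCommGroup E] [NormedSpace ℝ E]

/-- Proper separation of a spanning convex set from the origin. -/
theorem exists_nonneg_of_span_eq_top [FiniteDimensional ℝ E] {K : Set E} (hK : Convex ℝ K) (hne : K.Nonempty)
    (h0 : (0 : E) ∉ K) (hspan : Submodule.span ℝ K = ⊤) :
    ∃ φ : E →ₗ[ℝ] ℝ, (∀ x ∈ K, 0 ≤ φ x) ∧ ∃ x ∈ K, 0 < φ x := by
  -- Passing to the cone puts `0` in the affine hull, so spanning yields nonempty interior.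
  let T : Set E := {x | ∃ t : ℝ, 0 < t ∧ ∃ k ∈ K, x = t • k}
  have hKT : K ⊆ T := fun k hk => ⟨1, one_pos, k, hk, (one_smul _ _).symm⟩
  have hT : Convex ℝ T := by
    rintro _ ⟨s, hs, k, hk, rfl⟩ _ ⟨t, ht, l, hl, rfl⟩ a b ha hb hab
    have hpos : 0 < a * s + b * t := by
      rcases ha.eq_or_lt with rfl | ha'
      · have : b = 1 := by linarith
        subst this
        simpa using ht
      · have := mul_pos ha' hs
        have := mul_nonneg hb ht.le
        linarith
    refine ⟨a * s + b * t, hpos, (a * s / (a * s + b * t)) • k + (b * t / (a * s + b * t)) • l,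
      hK hk hl (by positivity) (by positivity) (by field_simp), ?_⟩
    rw [smul_add, smul_smul, smul_smul, smul_smul, smul_smul,
      mul_div_cancel₀ _ hpos.ne', mul_div_cancel₀ _ hpos.ne']
  have h0T : (0 : E) ∉ T := by
    rintro ⟨t, ht, k, hk, h⟩
    rcases smul_eq_zero.mp h.symm with h | h
    · exact ht.ne' h
    · exact h0 (h ▸ hk)
  have haff : affineSpan ℝ T = ⊤ := by
    obtain ⟨k, hk⟩ := hne
    have hz : (0 : E) ∈ affineSpan ℝ T := by
      have h1 : k ∈ affineSpan ℝ T := subset_affineSpan ℝ T (hKT hk)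
      have h2 : (2 : ℝ) • k ∈ affineSpan ℝ T :=
        subset_affineSpan ℝ T ⟨2, two_pos, k, hk, rfl⟩
      have h3 := AffineMap.lineMap_mem (-1 : ℝ) h1 h2
      rw [AffineMap.lineMap_apply] at h3
      convert h3 using 1
      simp only [vsub_eq_sub, vadd_eq_add]
      module
    have hspanT : Submodule.span ℝ T = ⊤ := top_unique (hspan ▸ Submodule.span_mono hKT)
    have hins := affineSpan_insert_zero (k := ℝ) T
    rw [hspanT, affineSpan_insert_eq_affineSpan ℝ hz] at hins
    exact SetLike.coe_injective (by simpa using hins)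
  have hint : (interior T).Nonempty := hT.interior_nonempty_iff_affineSpan_eq_top.mpr haff
  obtain ⟨φ, hφ⟩ := geometric_hahn_banach_point_open hT.interior isOpen_interior
    (fun h => h0T (interior_subset h))
  have hcl : closure (interior T) ⊆ {x | 0 ≤ φ x} :=
    closure_minimal (fun x hx => by simpa using (hφ x hx).le)
      (isClosed_le continuous_const φ.continuous)
  rw [hT.closure_interior_eq_closure_of_nonempty_interior hint] at hcl
  refine ⟨φ.toLinearMap, fun x hx => hcl (subset_closure (hKT hx)), ?_⟩
  obtain ⟨x, hx⟩ := hint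
  obtain ⟨t, ht, k, hk, rfl⟩ := interior_subset hx
  have := hφ _ hx
  rw [map_zero, map_smul, smul_eq_mul] at this
  exact ⟨k, hk, pos_of_mul_pos_right this ht.le⟩

/-- Proper separation of a convex set from the origin in a finite-dimensional space. -/
theorem exists_nonneg_of_zero_notMem [FiniteDimensional ℝ E] {K : Set E} (hK : Convex ℝ K) (hne : K.Nonempty)
    (h0 : (0 : E) ∉ K) :
    ∃ φ : E →ₗ[ℝ] ℝ, (∀ x ∈ K, 0 ≤ φ x) ∧ ∃ x ∈ K, 0 < φ x := by
  obtain ⟨k, hk⟩ := hne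
  obtain ⟨φ, hφ, x, hx, hx'⟩ := exists_nonneg_of_span_eq_top
    (K := ((↑) : Submodule.span ℝ K → E) ⁻¹' K)
    (hK.linear_preimage (Submodule.span ℝ K).subtype) ⟨⟨k, Submodule.subset_span hk⟩, hk⟩
    h0 Submodule.span_span_coe_preimage
  obtain ⟨ψ, hψ⟩ := φ.exists_extend
  have hval (y : Submodule.span ℝ K) : ψ y = φ y := LinearMap.congr_fun hψ y
  refine ⟨ψ, fun y hy => ?_, x, hx, by rwa [hval]⟩
  have := hφ ⟨y, Submodule.subset_span hy⟩ hy
  rwa [← hval] at this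

/-- Proper separation of two disjoint convex sets in a finite-dimensional space. -/
theorem exists_proper_separation [FiniteDimensional ℝ E] {A B : Set E}
    (hA : Convex ℝ A) (hB : Convex ℝ B) (hAne : A.Nonempty) (hBne : B.Nonempty) (hAB : Disjoint A B) :
    ∃ φ : E →ₗ[ℝ] ℝ, (∀ x ∈ A, ∀ y ∈ B, φ y ≤ φ x) ∧ ∃ x ∈ A, ∃ y ∈ B, φ y < φ x := by
  obtain ⟨φ, hφ, z, hz, hlt⟩ := exists_nonneg_of_zero_notMem (hA.sub hB) (hAne.sub hBne) (by
    rintro ⟨x, hx, y, hy, hxy⟩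
    exact hAB.ne_of_mem hx hy (sub_eq_zero.mp hxy))
  obtain ⟨x, hx, y, hy, rfl⟩ := hz
  refine ⟨φ, fun x hx y hy => ?_, x, hx, y, hy, ?_⟩
  · simpa using hφ _ (Set.sub_mem_sub hx hy)
  · simpa using hlt

/-- A linear functional attaining its minimum over a set at a relative interior point is
constant on the set. -/
theorem eq_of_isMin_of_mem_intrinsicInterior {s : Set E} {z₀ : E}
    (hz₀ : z₀ ∈ intrinsicInterior ℝ s) (φ : E →ₗ[ℝ] ℝ) (hmin : ∀ z ∈ s, φ z₀ ≤ φ z)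
    {z : E} (hz : z ∈ s) : φ z = φ z₀ := by
  obtain ⟨w, hw, rfl⟩ := mem_intrinsicInterior.mp hz₀
  have hmem (t : ℝ) : AffineMap.lineMap (w : E) z t ∈ affineSpan ℝ s :=
    AffineMap.lineMap_mem t w.2 (subset_affineSpan ℝ s hz)
  let γ : ℝ → affineSpan ℝ s := fun t => ⟨AffineMap.lineMap (w : E) z t, hmem t⟩
  have hγ : Continuous γ := Continuous.subtype_mk AffineMap.lineMap_continuous hmem
  have hγ0 : γ 0 = w := Subtype.ext (AffineMap.lineMap_apply_zero _ _)
  have hev : ∀ᶠ t in nhds (0 : ℝ), (γ t : E) ∈ s := by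
    have := hγ.continuousAt (x := 0)
    rw [ContinuousAt, hγ0] at this
    exact this (mem_interior_iff_mem_nhds.mp hw)
  obtain ⟨ε, hε, hball⟩ := Metric.eventually_nhds_iff.mp hev
  -- Stepping slightly past the minimizer, away from `z`, stays in `s` and reverses the inequality.
  have hneg := hmin _ (hball (y := -(ε / 2)) (by
    rw [Real.dist_eq, sub_zero, abs_neg, abs_of_pos (by positivity)]; linarith))
  simp only [γ, AffineMap.lineMap_apply, vsub_eq_sub, vadd_eq_add, map_add, map_smul, map_sub,
    smul_eq_mul] at hneg
  have := hmin z hz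
  nlinarith

end Separation

section SumRule

variable {E : Type*} [NormedAddCommGroup E] [InnerProductSpace ℝ E] [FiniteDimensional ℝ E]

/-- An affine lower bound, touching at `zbar`, of a nearly convex function on a nearly convex
set splits into a subgradient of the function and a normal to the set. -/
theorem exists_subgradient_sub_mem_normalCone {f : E → EReal} {Ω : Set E}
    (hbot : ∀ z, ⊥ < f z) (hf : NearlyConvexFun f) (hΩ : NearlyConvexSet Ω)
    (hqc : (intrinsicInterior ℝ (effDom f) ∩ intrinsicInterior ℝ Ω).Nonempty)
    {zbar ω : E} {r : ℝ} (hzbar : zbar ∈ Ω) (hr : f zbar = r)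
    (hω : ∀ z ∈ Ω, ((r + inner ℝ ω (z - zbar) : ℝ) : EReal) ≤ f z) :
    ∃ a ∈ subdifferential f zbar, ω - a ∈ normalCone zbar Ω := by
  obtain ⟨C, hC, hCf, hfC⟩ := hf
  obtain ⟨B, hB, hBΩ, hΩB⟩ := hΩ
  obtain ⟨z₀, hz₀f, hz₀Ω⟩ := hqc
  have hreal {z : E} (hz : z ∈ effDom f) : ∃ s : ℝ, f z = s :=
    ⟨(f z).toReal, (EReal.coe_toReal (ne_of_lt hz) (hbot z).ne').symm⟩
  have hCne : C.Nonempty :=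
    closure_nonempty_iff.mp ⟨(zbar, r), hfC (show f zbar ≤ r from hr.le)⟩
  obtain ⟨b₀, hb₀⟩ : B.Nonempty := closure_nonempty_iff.mp ⟨zbar, hΩB hzbar⟩
  -- Strictness makes `D` disjoint from the convex core `C` of the epigraph.
  let D : Set (E × ℝ) := {q | q.1 ∈ B ∧ q.2 < r + inner ℝ ω (q.1 - zbar)}
  have hD : Convex ℝ D := by
    rintro ⟨x, s⟩ ⟨hx, hs⟩ ⟨y, t⟩ ⟨hy, ht⟩ a b ha hb hab
    refine ⟨hB hx hy ha hb hab, ?_⟩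
    simp only [Prod.smul_mk, Prod.mk_add_mk, smul_eq_mul, inner_sub_right, inner_add_right,
      inner_smul_right] at hs ht ⊢
    have hb' : b = 1 - a := by linarith
    subst hb'
    rcases ha.eq_or_lt with rfl | ha'
    · linarith
    · nlinarith [mul_lt_mul_of_pos_left hs ha', mul_le_mul_of_nonneg_left ht.le hb]
  have hdisj : Disjoint C D := by
    rw [Set.disjoint_left]
    rintro ⟨x, s⟩ hx ⟨hxB, hs⟩
    have h1 : ((r + inner ℝ ω (x - zbar) : ℝ) : EReal) ≤ s := (hω x (hBΩ hxB)).trans (hCf hx)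
    exact absurd (EReal.coe_le_coe_iff.mp h1) (not_le.mpr hs)
  obtain ⟨Φ, hΦ, ⟨x₁, s₁⟩, hx₁, ⟨x₂, s₂⟩, hx₂, hlt⟩ := exists_proper_separation hC hD hCne
    ⟨(b₀, r + inner ℝ ω (b₀ - zbar) - 1), hb₀, sub_one_lt _⟩ hdisj
  let φ : E →ₗ[ℝ] ℝ := Φ ∘ₗ LinearMap.inl ℝ E ℝ
  let t : ℝ := Φ (0, 1)
  have hΦeq (z : E) (s : ℝ) : Φ (z, s) = φ z + s * t := by
    have : (z, s) = (z, (0 : ℝ)) + s • ((0 : E), (1 : ℝ)) := by simp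
    rw [this, map_add, map_smul]
    rfl
  have hφc : Continuous φ := φ.continuous_of_finiteDimensional
  have hΦc : Continuous Φ := Φ.continuous_of_finiteDimensional
  have hepi (q : E × ℝ) (hq : q ∈ epigraph f) (d : E × ℝ) (hd : d ∈ D) : Φ d ≤ Φ q :=
    closure_minimal (t := {q | Φ d ≤ Φ q}) (fun q hq => hΦ q hq d hd)
      (isClosed_le continuous_const hΦc) (hfC hq)
  -- `D` is unbounded below, so a negative `t` would make `Φ` unbounded above on it.
  have ht : 0 ≤ t := by
    by_contra! ht
    have h1 (k : ℝ) (hk : 0 < k) := hepi (zbar, r) (show f zbar ≤ r from hr.le)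
      (b₀, r + inner ℝ ω (b₀ - zbar) - k) ⟨hb₀, sub_lt_self (r + inner ℝ ω (b₀ - zbar)) hk⟩
    simp only [hΦeq] at h1
    set c := φ zbar + r * t - φ b₀ - (r + inner ℝ ω (b₀ - zbar)) * t with hc
    have h2 := h1 ((|c| + 1) / (-t)) (div_pos (by positivity) (neg_pos.mpr ht))
    have h3 : (|c| + 1) / (-t) * t = -(|c| + 1) := by
      have := ht.ne
      field_simp
    have := le_abs_self c
    linarith
  have hsep (z : E) (s : ℝ) (hz : f z = s) (y : E) (hy : y ∈ Ω) :
      φ y + (r + inner ℝ ω (y - zbar)) * t ≤ φ z + s * t := by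
    refine closure_minimal
      (t := {y | φ y + (r + inner ℝ ω (y - zbar)) * t ≤ φ z + s * t}) (fun y hy => ?_)
      (isClosed_le (by fun_prop) continuous_const) (hΩB hy)
    rw [Set.mem_ofPred_eq]
    refine le_of_forall_pos_le_add fun ε hε => ?_
    -- `t + 1` rather than `t`, since `t = 0` is not yet excluded.
    have hε' : 0 < ε / (t + 1) := by positivity
    have h1 := hepi (z, s) (show f z ≤ s from hz.le)
      (y, r + inner ℝ ω (y - zbar) - ε / (t + 1)) ⟨hy, sub_lt_self _ hε'⟩
    simp only [hΦeq] at h1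
    have h2 : ε / (t + 1) * t ≤ ε := by
      rw [div_mul_eq_mul_div, div_le_iff₀ (by positivity)]
      nlinarith
    linarith
  -- If `t = 0`, then `φ` separates `effDom f` from `Ω`; being extremal at the common relative
  -- interior point `z₀`, it equals `φ z₀` on both, against proper separation.
  have htpos : 0 < t := by
    refine ht.lt_of_ne fun ht0 => ?_
    have hsep' (z : E) (hz : z ∈ effDom f) (y : E) (hy : y ∈ Ω) : φ y ≤ φ z := by
      obtain ⟨s, hs⟩ := hreal hz
      simpa [← ht0] using hsep z s hs y hy
    have h1 := eq_of_isMin_of_mem_intrinsicInterior hz₀f φ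
      (fun z hz => hsep' z hz z₀ (intrinsicInterior_subset hz₀Ω))
      (show x₁ ∈ effDom f from lt_of_le_of_lt (hCf hx₁) (EReal.coe_lt_top s₁))
    have h2 := eq_of_isMin_of_mem_intrinsicInterior hz₀Ω (-φ)
      (fun z hz => by simpa using hsep' z₀ (intrinsicInterior_subset hz₀f) z hz) (hBΩ hx₂.1)
    simp only [hΦeq, ← ht0, LinearMap.neg_apply] at hlt h2
    linarith
  -- The slope of the separating hyperplane, now non-vertical.
  let a : E := (InnerProductSpace.toDual ℝ E).symm (LinearMap.toContinuousLinearMap (-(t⁻¹ • φ)))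
  have ha (z : E) : inner ℝ a z * t = -φ z := by
    have : inner ℝ a z = -(t⁻¹ * φ z) := by
      simp only [a, InnerProductSpace.toDual_symm_apply]
      simp
    rw [this]
    field_simp
  refine ⟨a, fun z => ?_, fun z hz => ?_⟩
  · rw [hr]
    rcases eq_or_ne (f z) ⊤ with htop | htop
    · simp [htop]
    · obtain ⟨s, hs⟩ := hreal (lt_top_iff_ne_top.mpr htop)
      have h1 := hsep z s hs zbar hzbar
      rw [hs, ← EReal.coe_sub, EReal.coe_le_coe_iff]
      refine le_of_mul_le_mul_right ?_ htpos
      rw [ha, map_sub]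
      rw [sub_self, inner_zero_right] at h1
      linarith
  · have h1 := hsep zbar r hr z hz
    have h2 := ha (z - zbar)
    rw [map_sub] at h2
    rw [inner_sub_left]
    refine le_of_mul_le_mul_right ?_ htpos
    linarith

end SumRule

end NearConv

theorem theorem5p3 {n p : ℕ}
    (f : NearConv.EucProd n p → EReal)
    (F : NearConv.Euc n → Set (NearConv.Euc p))
    (hf_proper : NearConv.ProperFun f)
    (hf : NearConv.NearlyConvexFun f)
    (hF : NearConv.NearlyConvexMap F)
    (hqc : (intrinsicInterior ℝ (NearConv.effDom f) ∩
      intrinsicInterior ℝ (NearConv.graph F)).Nonempty)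
    (xbar : NearConv.Euc n)
    (hxbar : ∃ r : ℝ, NearConv.optimalValue f F xbar = (r : EReal))
    (ybar : NearConv.Euc p)
    (hybar : ybar ∈ NearConv.solutionMap f F xbar) :
    NearConv.subdifferential (NearConv.optimalValue f F) xbar =
      ⋃ (u : NearConv.Euc n) (v : NearConv.Euc p)
        (_ : NearConv.pair u v ∈ NearConv.subdifferential f (NearConv.pair xbar ybar)),
        (fun u' => u + u') '' NearConv.coderivative F xbar ybar v := by
  obtain ⟨r, hr⟩ := hxbar
  obtain ⟨hyF, hfr⟩ := hybar
  rw [hr] at hfr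
  ext w
  simp only [Set.mem_iUnion, Set.mem_image, exists_prop]
  constructor
  · intro hw
    obtain ⟨a, ha, han⟩ := NearConv.exists_subgradient_sub_mem_normalCone hf_proper.2 hf hF hqc
      (zbar := NearConv.pair xbar ybar) (ω := NearConv.pair w 0) hyF hfr (fun z hz => by
        have h1 := EReal.add_le_of_le_sub (hw z.fst)
        have h2 : NearConv.optimalValue f F z.fst ≤ f z := iInf₂_le z.snd hz
        rw [hr, ← EReal.coe_add, add_comm] at h1
        simpa [WithLp.prod_inner_apply] using h1.trans h2)
    refine ⟨a.fst, a.snd, ha, w - a.fst, ?_, add_sub_cancel _ _⟩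
    have heq : NearConv.pair (w - a.fst) (-a.snd) = NearConv.pair w 0 - a :=
      WithLp.ofLp_injective 2 (Prod.ext (by simp) (by simp))
    rwa [NearConv.coderivative, Set.mem_ofPred_eq, heq]
  · rintro ⟨u, v, huv, u', hu', rfl⟩ x
    rw [hr, EReal.le_sub_iff_add_le (by simp) (by simp)]
    refine le_iInf₂ fun y hy => ?_
    have h1 := EReal.add_le_of_le_sub (huv (NearConv.pair x y))
    have h2 := hu' (NearConv.pair x y) hy
    rw [hfr] at h1
    refine le_trans ?_ h1
    rw [← EReal.coe_add, ← EReal.coe_add, EReal.coe_le_coe_iff]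
    simp only [WithLp.prod_inner_apply, WithLp.ofLp_sub, Prod.fst_sub, Prod.snd_sub,
      inner_neg_left, inner_add_left] at h2 ⊢
    linarith
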